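/- Let $R$ be a commutative ring graded by an abelian group $A$ (for $A=0$: any commutative ring), let $a\in A$, and let $d\ge 0$ be an integer. A *differential module* is an $R$-module with a decomposition $D=\bigoplus_{b\in A,\ j\in\mathbb Z/d} D_{b,j}$ such that $R_b\cdot D_{c,j}\subseteq D_{b+c,j}$, together with an $R$-linear map $d^D:D\to D$ such that $(d^D)^2=0$ and $d^D(D_{b,j})\subseteq D_{b+a,j-1}$. (For $d=1$ and $A=0$ this is a module with a square-zero endomorphism.) A *morphism* $\phi:D\to D'$ of differential modules is an $R$-linear map with $\phi(D_{b,j})\subseteq D'_{b,j}$ and $d^{D'}\phi=\phi d^D$. A *flag* is a differential module $D$ with an exhaustive filtration $0=D^{-1}\subseteq D^0\subseteq D^1\subseteq\cdots$, $\bigcup_i D^i=D$, by graded submodules such that $d^D(D^i)\subseteq D^{i-1}$ for all $i$. It is *$R$-projective* if every quotient $D^i/D^{i-1}$ is a projective $R$-module. Its *anchor* is the complex $$\cdots\to D^2/D^1\to D^1/D^0\to D^0\to 0$$ with the differential induced by $d^D$ (it is the direct sum of its graded strands), and $D$ is *anchored on a resolution* if the homology of the anchor vanishes in all degrees $i\neq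 0$. A map $\psi:D\to D'$ of flags is *flag-preserving* if $\psi(D^i)\subseteq D'^i$ for all $i$. **Theorem.** Let $D$ and $D'$ be $R$-projective flags anchored on resolutions, and let $\phi:D\to D'$ be any morphism of differential modules, not necessarily flag-preserving. Then there exist a flag-preserving morphism of differential modules $\psi:D\to D'$ and an $R$-linear map $h:D\to D'$ with $h(D_{b,j})\subseteq D'_{b-a,j+1}$ such that $$\phi-\psi=d^{D'}h+h\,d^D.$$ No finiteness assumption is made on $R$, $D$ or $D'$. -/

import Mathlib

/-!
`R` is a commutative ring graded by an abelian group `A` (the auxiliary grading; for `A` trivial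
this is a plain commutative ring), `a : A` is the auxiliary degree of the differentials, and `d`
is the modulus of the ambient `ℤ/d`-grading (`d = 1`: no grading; `d = 0`: a `ℤ`-grading).
-/

universe u v w t

namespace DiffMod

/-- A `ℤ/d`-graded differential `R`-module, homogeneous of degree `a` for the auxiliary grading:
a graded module `⨁ piece (b, j)`, `b : A`, `j : ℤ/d`, with a square-zero `R`-linear endomorphism of
auxiliary degree `a` and `ℤ/d`-degree `-1`. The ring `R` lies in `ℤ/d`-degree `0`. -/
structure DM {R : Type u} [CommRing R] {A : Type t} [AddCommGroup A] [DecidableEq A]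
    (𝓡 : A → AddSubgroup R) (a : A) (d : ℕ) where
  carrier : Type v
  [addCommGroup : AddCommGroup carrier]
  [module : Module R carrier]
  piece : A × ZMod d → AddSubgroup carrier
  [decomposition : DirectSum.Decomposition piece]
  smul_mem : ∀ (b c : A) (j : ZMod d) (r : R) (x : carrier),
    r ∈ 𝓡 b → x ∈ piece (c, j) → r • x ∈ piece (b + c, j)
  diff : carrier →ₗ[R] carrier
  diff_mem : ∀ (b : A) (j : ZMod d) (x : carrier),
    x ∈ piece (b, j) → diff x ∈ piece (b + a, j - 1)
  diff_diff : ∀ x : carrier, diff (diff x) = 0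

attribute [instance] DM.addCommGroup DM.module DM.decomposition

variable {R : Type u} [CommRing R] {A : Type t} [AddCommGroup A] [DecidableEq A]
  {𝓡 : A → AddSubgroup R} {a : A} {d : ℕ}

/-- An `R`-linear map is a morphism of graded differential modules if it has degree `0` for both
gradings and commutes with the differentials. -/
structure IsMorphism (D : DM.{u, v, t} 𝓡 a d) (D' : DM.{u, w, t} 𝓡 a d)
    (φ : D.carrier →ₗ[R] D'.carrier) : Prop where
  map_mem : ∀ (b : A) (j : ZMod d) (x : D.carrier), x ∈ D.piece (b, j) → φ x ∈ D'.piece (b, j)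
  comm : ∀ x : D.carrier, D'.diff (φ x) = φ (D.diff x)

/-- `h` is a homotopy from `φ` to `ψ`: it has `ℤ/d`-degree `1` and auxiliary degree `-a`
(opposite to the differentials), and `φ - ψ = d h + h d`. -/
structure IsHomotopy (D : DM.{u, v, t} 𝓡 a d) (D' : DM.{u, w, t} 𝓡 a d)
    (φ ψ h : D.carrier →ₗ[R] D'.carrier) : Prop where
  map_mem : ∀ (b : A) (j : ZMod d) (x : D.carrier),
    x ∈ D.piece (b, j) → h x ∈ D'.piece (b - a, j + 1)
  eq : φ - ψ = D'.diff ∘ₗ h + h ∘ₗ D.diff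

/-- A flag: a graded differential module with an exhaustive filtration
`0 = fil (-1) ≤ fil 0 ≤ fil 1 ≤ ⋯` by graded submodules, strictly lowered by the differential. -/
structure Flag {R : Type u} [CommRing R] {A : Type t} [AddCommGroup A] [DecidableEq A]
    (𝓡 : A → AddSubgroup R) (a : A) (d : ℕ) extends DM.{u, v, t} 𝓡 a d where
  fil : ℤ → Submodule R carrier
  fil_homogeneous : ∀ i : ℤ, (fil i).IsHomogeneous piece
  fil_mono : Monotone fil
  fil_neg : ∀ i : ℤ, i < 0 → fil i = ⊥
  fil_exhaustive : ∀ x : carrier, ∃ i : ℤ, x ∈ fil i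
  diff_fil : ∀ (i : ℤ) (x : carrier), x ∈ fil i → diff x ∈ fil (i - 1)

namespace Flag

/-- The `i`-th module `fil i / fil (i - 1)` of the anchor (summed over all internal degrees). -/
abbrev gr (D : Flag.{u, v, t} 𝓡 a d) (i : ℤ) : Type v :=
  D.fil i ⧸ (D.fil (i - 1)).submoduleOf (D.fil i)

/-- The differential of `D` as a map `fil i → fil j` for `j = i - 1`. -/
def diffFil (D : Flag.{u, v, t} 𝓡 a d) (i j : ℤ) (hij : j + 1 = i) : D.fil i →ₗ[R] D.fil j :=
  D.diff.restrict fun x hx => by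
    obtain rfl : j = i - 1 := by omega
    exact D.diff_fil i x hx

/-- The differential `gr i → gr j`, `j = i - 1`, of the anchor, induced by that of `D`. -/
def anchorDiff (D : Flag.{u, v, t} 𝓡 a d) (i j : ℤ) (hij : j + 1 = i) : D.gr i →ₗ[R] D.gr j :=
  Submodule.mapQ _ _ (D.diffFil i j hij) fun x hx => by
    obtain rfl : j = i - 1 := by omega
    exact D.diff_fil (i - 1) x.1 hx

theorem anchorDiff_comp (D : Flag.{u, v, t} 𝓡 a d) (i j k : ℤ) (hij : j + 1 = i)
    (hjk : k + 1 = j) (x : D.gr i) : D.anchorDiff j k hjk (D.anchorDiff i j hij x) = 0 := by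
  obtain ⟨y, rfl⟩ := Submodule.Quotient.mk_surjective _ x
  have : D.diffFil j k hjk (D.diffFil i j hij y) = 0 := Subtype.ext (D.diff_diff y.1)
  simp [anchorDiff, this]

/-- A projective flag: all associated graded pieces of the filtration are projective modules. -/
def IsProjective (D : Flag.{u, v, t} 𝓡 a d) : Prop :=
  ∀ i : ℤ, Module.Projective R (D.gr i)

/-- The anchor is a resolution: its homology is concentrated in degree `0`. -/
def AnchoredOnResolution (D : Flag.{u, v, t} 𝓡 a d) : Prop :=
  ∀ i : ℤ, i ≠ 0 → Function.Exact
    (D.anchorDiff (i + 1) i rfl) (D.anchorDiff i (i - 1) (sub_add_cancel i 1))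

/-- A linear map between flags is flag-preserving if it maps `fil i` into `fil i` for all `i`. -/
def FlagPreserving (D : Flag.{u, v, t} 𝓡 a d) (D' : Flag.{u, w, t} 𝓡 a d)
    (φ : D.carrier →ₗ[R] D'.carrier) : Prop :=
  ∀ (i : ℤ) (x : D.carrier), x ∈ D.fil i → φ x ∈ D'.fil i

end Flag

end DiffMod

/-! Ignore the grading at first and build `h` by induction along the filtration of `D`, so that `φ -
d h - h d` preserves the filtration. If `h` works on `fil (i - 1)`, then `y = φ - h d` makes sense
on `fil i`, and `d y` lands in `fil (i - 1)` of `D'`. Exactness of the anchor of `D'` in positive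
degrees puts `y x` in `im d + fil i` (`exists_sub_diff_mem`), and projectivity of `gr i` makes the
choice linear (`exists_extension`). The union of these maps is a homotopy that need not be
homogeneous. Its component of degree `(-a, 1)` is the required one: the degree `0` component of the
homotopy identity is again such an identity, and it respects the filtrations because they are
homogeneous. -/

namespace DiffMod

/-! ### Homogeneous components of maps between graded modules -/

section HomogeneousComponent

variable {G : Type*} [DecidableEq G] {M N : Type*} [AddCommGroup M]
  [AddCommGroup N] (𝓜 : G → AddSubgroup M) (𝓝 : G → AddSubgroup N)
  [DirectSum.Decomposition 𝓜] [DirectSum.Decomposition 𝓝]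

/-- The projection of a graded abelian group onto its piece of degree `i`, as an endomorphism. -/
def gradedProj (i : G) : M →+ M where
  toFun x := (DirectSum.decompose 𝓜 x i : M)
  map_zero' := by simp
  map_add' x y := by simp

theorem gradedProj_mem (i : G) (x : M) : gradedProj 𝓜 i x ∈ 𝓜 i :=
  (DirectSum.decompose 𝓜 x i).2

theorem gradedProj_of_mem {i : G} {x : M} (hx : x ∈ 𝓜 i) : gradedProj 𝓜 i x = x :=
  DirectSum.decompose_of_mem_same 𝓜 hx

theorem gradedProj_of_mem_ne {i j : G} {x : M} (hx : x ∈ 𝓜 i) (hij : i ≠ j) :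
    gradedProj 𝓜 j x = 0 :=
  DirectSum.decompose_of_mem_ne 𝓜 hx hij

variable [AddCommGroup G]

/-- Homogeneous maps of degree `g` intertwine the projections onto homogeneous pieces. -/
theorem gradedProj_map (f : M →+ N) (g : G) (hf : ∀ i, ∀ x ∈ 𝓜 i, f x ∈ 𝓝 (i + g))
    (i : G) (x : M) : gradedProj 𝓝 (i + g) (f x) = f (gradedProj 𝓜 i x) := by
  induction x using DirectSum.Decomposition.inductionOn 𝓜 with
  | zero => simp
  | @homogeneous k m =>
    by_cases hik : k = i
    · subst hik
      rw [gradedProj_of_mem 𝓝 (hf k _ m.2), gradedProj_of_mem 𝓜 m.2]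
    · rw [gradedProj_of_mem_ne 𝓜 m.2 hik, map_zero,
        gradedProj_of_mem_ne 𝓝 (hf k _ m.2) fun h => hik (add_right_cancel h)]
  | add x y hx hy => simp only [map_add, hx, hy]

/-- The homogeneous component of degree `g` of an additive map between graded groups. -/
def homogeneousComponent (g : G) (f : M →+ N) : M →+ N :=
  (DirectSum.toAddMonoid fun i =>
    ((gradedProj 𝓝 (i + g)).comp f).comp (𝓜 i).subtype).comp
    (DirectSum.decomposeAddEquiv 𝓜).toAddMonoidHom

theorem homogeneousComponent_of_mem (g : G) (f : M →+ N) {i : G} {x : M} (hx : x ∈ 𝓜 i) :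
    homogeneousComponent 𝓜 𝓝 g f x = gradedProj 𝓝 (i + g) (f x) := by
  simp [homogeneousComponent, DirectSum.decompose_of_mem 𝓜 hx]

/-- Ensures that passing to a component keeps a map flag-preserving. -/
theorem homogeneousComponent_mem_of_homogeneous {S : Type*} [SetLike S M] [AddSubmonoidClass S M]
    {T : Type*} [SetLike T N] [AddSubmonoidClass T N] {p : S} {q : T}
    (hp : ∀ i, ∀ x ∈ p, gradedProj 𝓜 i x ∈ p) (hq : ∀ i, ∀ x ∈ q, gradedProj 𝓝 i x ∈ q)
    (g : G) (f : M →+ N) (hf : ∀ x ∈ p, f x ∈ q) {x : M} (hx : x ∈ p) :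
    homogeneousComponent 𝓜 𝓝 g f x ∈ q := by
  classical
  rw [← DirectSum.sum_support_decompose 𝓜 x, map_sum]
  refine sum_mem fun i _ => ?_
  rw [homogeneousComponent_of_mem 𝓜 𝓝 g f (SetLike.coe_mem _)]
  exact hq _ _ (hf _ (hp i x hx))

end HomogeneousComponent

variable {R : Type u} [CommRing R] {A : Type t} [AddCommGroup A] [DecidableEq A]
  {𝓡 : A → AddSubgroup R} {a : A} {d : ℕ}

theorem DM.gradedProj_smul (D : DM.{u, v, t} 𝓡 a d) {b : A} {r : R} (hr : r ∈ 𝓡 b)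
    (i : A × ZMod d) (x : D.carrier) :
    gradedProj D.piece (i + (b, 0)) (r • x) = r • gradedProj D.piece i x := by
  refine gradedProj_map D.piece D.piece (DistribSMul.toAddMonoidHom D.carrier r) (b, 0) ?_ i x
  rintro ⟨c, j⟩ y hy
  simpa [add_comm c b] using D.smul_mem b c j r y hr hy

theorem DM.gradedProj_diff (D : DM.{u, v, t} 𝓡 a d) (i : A × ZMod d) (x : D.carrier) :
    gradedProj D.piece (i + (a, -1)) (D.diff x) = D.diff (gradedProj D.piece i x) := by
  refine gradedProj_map D.piece D.piece D.diff.toAddMonoidHom (a, -1) ?_ i x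
  rintro ⟨c, j⟩ y hy
  simpa [sub_eq_add_neg] using D.diff_mem c j y hy

/-- The homogeneous component of degree `g` of a linear map between graded modules. -/
def DM.component [GradedRing 𝓡] (D : DM.{u, v, t} 𝓡 a d) (D' : DM.{u, w, t} 𝓡 a d)
    (g : A × ZMod d) (f : D.carrier →ₗ[R] D'.carrier) : D.carrier →ₗ[R] D'.carrier where
  __ := homogeneousComponent D.piece D'.piece g f.toAddMonoidHom
  map_smul' r x := by
    set F := homogeneousComponent D.piece D'.piece g f.toAddMonoidHom with hF
    change F (r • x) = r • F x
    -- By additivity, scalar and vector may be taken homogeneous; a scalar of degree `b` shifts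
    -- source and target degrees alike by `(b, 0)`.
    induction r using DirectSum.Decomposition.inductionOn 𝓡 with
    | zero => simp
    | add r s hr hs => simp only [add_smul, map_add, hr, hs]
    | @homogeneous b r =>
      induction x using DirectSum.Decomposition.inductionOn D.piece with
      | zero => simp
      | add x y hx hy => simp only [smul_add, map_add, hx, hy]
      | @homogeneous i x =>
        have hmem : (r : R) • (x : D.carrier) ∈ D.piece (i + (b, 0)) := by
          simpa [add_comm i.1 b, Prod.add_def] using D.smul_mem b i.1 i.2 r x r.2 x.2
        rw [hF, homogeneousComponent_of_mem D.piece D'.piece g _ hmem,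
          homogeneousComponent_of_mem D.piece D'.piece g _ x.2, add_right_comm,
          ← D'.gradedProj_smul r.2]
        simp

theorem DM.ext_of_homogeneous (D : DM.{u, v, t} 𝓡 a d) {N : Type*} [AddCommGroup N] [Module R N]
    {f g : D.carrier →ₗ[R] N} (h : ∀ i, ∀ x ∈ D.piece i, f x = g x) : f = g := by
  ext x
  induction x using DirectSum.Decomposition.inductionOn D.piece with
  | zero => simp
  | @homogeneous i m => exact h i m m.2
  | add x y hx hy => simp only [map_add, hx, hy]

section Component

variable [GradedRing 𝓡] (D : DM.{u, v, t} 𝓡 a d) (D' : DM.{u, w, t} 𝓡 a d)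

theorem DM.component_of_mem (g : A × ZMod d) (f : D.carrier →ₗ[R] D'.carrier)
    {i : A × ZMod d} {x : D.carrier} (hx : x ∈ D.piece i) :
    D.component D' g f x = gradedProj D'.piece (i + g) (f x) :=
  homogeneousComponent_of_mem D.piece D'.piece g _ hx

/-- The differential has degree `(a, -1)`, which cancels `(-a, 1)`. -/
theorem DM.diff_comp_component (f : D.carrier →ₗ[R] D'.carrier) :
    D'.diff ∘ₗ D.component D' (-a, 1) f = D.component D' 0 (D'.diff ∘ₗ f) := by
  refine D.ext_of_homogeneous fun i x hx => ?_
  rw [LinearMap.comp_apply, D.component_of_mem D' _ _ hx, D.component_of_mem D' _ _ hx,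
    ← D'.gradedProj_diff, LinearMap.comp_apply]
  congr 2
  ext <;> simp

theorem DM.component_comp_diff (f : D.carrier →ₗ[R] D'.carrier) :
    D.component D' (-a, 1) f ∘ₗ D.diff = D.component D' 0 (f ∘ₗ D.diff) := by
  refine D.ext_of_homogeneous fun i x hx => ?_
  rw [LinearMap.comp_apply, D.component_of_mem D' _ _ (D.diff_mem i.1 i.2 x hx),
    D.component_of_mem D' _ _ hx, LinearMap.comp_apply]
  congr 2
  ext <;> simp

theorem DM.component_zero_of_isMorphism {φ : D.carrier →ₗ[R] D'.carrier}
    (hφ : IsMorphism D D' φ) : D.component D' 0 φ = φ := by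
  refine D.ext_of_homogeneous fun i x hx => ?_
  rw [D.component_of_mem D' _ _ hx, add_zero, gradedProj_of_mem D'.piece (hφ.map_mem i.1 i.2 x hx)]

theorem DM.component_sub (g : A × ZMod d) (f f' : D.carrier →ₗ[R] D'.carrier) :
    D.component D' g (f - f') = D.component D' g f - D.component D' g f' := by
  refine D.ext_of_homogeneous fun i x hx => ?_
  simp only [LinearMap.sub_apply, D.component_of_mem D' _ _ hx, map_sub]

end Component

/-! ### Construction of the homotopy along the filtration -/

namespace Flag

/-- Every element of a flag anchored on a resolution whose differential lies in `fil (i - 1)`,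
`i ≥ 0`, is congruent to a boundary modulo `fil i`. -/
theorem exists_sub_diff_mem (D : Flag.{u, v, t} 𝓡 a d) (hD : D.AnchoredOnResolution)
    {i : ℤ} (hi : 0 ≤ i) {y : D.carrier} (hy : D.diff y ∈ D.fil (i - 1)) :
    ∃ z, y - D.diff z ∈ D.fil i := by
  -- Induction on the excess `n`: above level `i`, the leading class of `y` is a cycle of the anchor
  -- in positive degree, hence a boundary. Subtracting `d z` lowers the level and leaves `d y`
  -- unchanged.
  have key : ∀ (n : ℕ) (y : D.carrier), y ∈ D.fil (i + n) → D.diff y ∈ D.fil (i - 1) →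
      ∃ z, y - D.diff z ∈ D.fil i := by
    intro n
    induction n with
    | zero => exact fun y hy _ => ⟨0, by simpa using hy⟩
    | succ n ih =>
      intro y hyn hy
      set k : ℤ := i + (n + 1 : ℕ) with hk
      have hcycle : D.anchorDiff k (k - 1) (sub_add_cancel k 1)
          (Submodule.Quotient.mk ⟨y, hyn⟩) = 0 := by
        refine (Submodule.Quotient.mk_eq_zero _).2 ?_
        exact D.fil_mono (by push_cast at hk; omega) hy
      obtain ⟨w, hw⟩ := (hD k (by push_cast at hk; omega) _).1 hcycle
      obtain ⟨z, rfl⟩ := Submodule.Quotient.mk_surjective _ w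
      have hyz : y - D.diff z ∈ D.fil (i + n) := by
        have := (Submodule.Quotient.eq _).1 hw.symm
        exact D.fil_mono (by push_cast at hk; omega) this
      obtain ⟨z', hz'⟩ := ih (y - D.diff z) hyz (by simpa [D.diff_diff] using hy)
      exact ⟨z + z', by simpa [sub_sub] using hz'⟩
  obtain ⟨k, hk⟩ := D.fil_exhaustive y
  exact key (k - i).toNat y (D.fil_mono (by omega) hk) hy

section Lift

variable (D : Flag.{u, v, t} 𝓡 a d) (D' : Flag.{u, w, t} 𝓡 a d)

/-- `h`, defined on `fil i`, is a homotopy from `φ` to a flag-preserving map there. -/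
def IsPartialHomotopy (φ : D.carrier →ₗ[R] D'.carrier) (i : ℤ)
    (h : D.fil i →ₗ[R] D'.carrier) : Prop :=
  ∀ k ≤ i, ∀ (x : D.carrier) (_ : x ∈ D.fil k) (hx : x ∈ D.fil i) (hdx : D.diff x ∈ D.fil i),
    φ x - D'.diff (h ⟨x, hx⟩) - h ⟨D.diff x, hdx⟩ ∈ D'.fil k

variable {D D'}

/-- A splitting `s` of `fil i → gr i` gives a complement of `fil j`, and only the values there
remain to be chosen. -/
theorem IsPartialHomotopy.exists_extension (hD : D.IsProjective)
    (hD'res : D'.AnchoredOnResolution) {φ : D.carrier →ₗ[R] D'.carrier}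
    (hφ : ∀ x, D'.diff (φ x) = φ (D.diff x)) {i j : ℤ} (hij : j + 1 = i) (hi : 0 ≤ i)
    {h : D.fil j →ₗ[R] D'.carrier} (hh : D.IsPartialHomotopy D' φ j h) :
    ∃ h' : D.fil i →ₗ[R] D'.carrier, D.IsPartialHomotopy D' φ i h' ∧
      ∀ (x : D.carrier) (hx : x ∈ D.fil i) (hx' : x ∈ D.fil j), h' ⟨x, hx⟩ = h ⟨x, hx'⟩ := by
  obtain rfl : j = i - 1 := by omega
  have := hD i
  set q := ((D.fil (i - 1)).submoduleOf (D.fil i)).mkQ with hq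
  obtain ⟨s, hs⟩ := Module.projective_lifting_property q LinearMap.id (Submodule.mkQ_surjective _)
  have hqs (p) : q (s p) = p := LinearMap.congr_fun hs p
  have hmem (x : D.fil i) : (x : D.carrier) - s (q x) ∈ D.fil (i - 1) := by
    have h0 : q (x - s (q x)) = 0 := by rw [map_sub, hqs, sub_self]
    exact (Submodule.Quotient.mk_eq_zero ((D.fil (i - 1)).submoduleOf (D.fil i))).1 h0
  let π : D.fil i →ₗ[R] D.fil (i - 1) :=
    LinearMap.codRestrict _ ((D.fil i).subtype ∘ₗ (LinearMap.id - s ∘ₗ q)) hmem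
  let y : D.fil i →ₗ[R] D'.carrier :=
    φ ∘ₗ (D.fil i).subtype - h ∘ₗ D.diffFil i (i - 1) hij
  -- `d (y x)` equals `(φ - d h - h d) (d x)`, since `d d x = 0`.
  have hy (x : D.fil i) : D'.diff (y x) ∈ D'.fil (i - 1) := by
    have hdx := D.diff_fil i x x.2
    have h1 := hh (i - 1) le_rfl (D.diff x) hdx hdx (by simp [D.diff_diff])
    have h2 : (⟨D.diff (D.diff x), by simp [D.diff_diff]⟩ : D.fil (i - 1)) = 0 :=
      Subtype.ext (D.diff_diff _)
    rw [h2, map_zero, sub_zero, ← hφ] at h1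
    rw [← map_sub] at h1
    exact h1
  -- The range of `T` is `im d + fil i`; lifting `y ∘ s` through `T` selects the primitives
  -- linearly.
  let T : D'.carrier × D'.fil i →ₗ[R] D'.carrier :=
    D'.diff.coprod (D'.fil i).subtype
  have hT (p : D.gr i) : y (s p) ∈ LinearMap.range T := by
    obtain ⟨z, hz⟩ := D'.exists_sub_diff_mem hD'res hi (hy (s p))
    exact ⟨(z, ⟨_, hz⟩), by simp [T]⟩
  obtain ⟨g, hg⟩ := Module.projective_lifting_property T.rangeRestrict
    (LinearMap.codRestrict (LinearMap.range T) (y ∘ₗ s) hT) T.surjective_rangeRestrict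
  have hg' (p : D.gr i) : y (s p) - D'.diff (g p).1 ∈ D'.fil i := by
    have h1 : T (g p) = y (s p) := congrArg Subtype.val (LinearMap.congr_fun hg p)
    rw [← h1]
    simp [T]
  let h' : D.fil i →ₗ[R] D'.carrier := h ∘ₗ π + LinearMap.fst R _ _ ∘ₗ g ∘ₗ q
  have hext (x : D.carrier) (hx : x ∈ D.fil i) (hx' : x ∈ D.fil (i - 1)) :
      h' ⟨x, hx⟩ = h ⟨x, hx'⟩ := by
    have h0 : q ⟨x, hx⟩ = 0 := (Submodule.Quotient.mk_eq_zero _).2 hx'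
    have hπ : π ⟨x, hx⟩ = ⟨x, hx'⟩ := Subtype.ext (by
      change x - (s (q ⟨x, hx⟩) : D.carrier) = x
      simp [h0])
    simp [h', h0, hπ]
  have hπs (p : D.gr i) : π (s p) = 0 := Subtype.ext (by
    change (s p : D.carrier) - (s (q (s p)) : D.carrier) = 0
    rw [hqs, sub_self])
  -- This is `φ - d h' - h' d` on `fil i`, because `h'` agrees with `h` on `d x ∈ fil (i - 1)`.
  let L : D.fil i →ₗ[R] D'.carrier := y - D'.diff ∘ₗ h'
  have hLs (p : D.gr i) : L (s p) ∈ D'.fil i := by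
    have h1 : h' (s p) = (g p).1 := by simp [h', hπs, hqs]
    simpa [L, h1] using hg' p
  have hLfil (k : ℤ) (hk : k ≤ i - 1) (x : D.fil i) (hx : (x : D.carrier) ∈ D.fil k) :
      L x ∈ D'.fil k := by
    have hx' : (x : D.carrier) ∈ D.fil (i - 1) := D.fil_mono hk hx
    have h1 := hh k hk x hx hx' (D.diff_fil i x x.2)
    rw [sub_right_comm, ← hext x x.2 hx'] at h1
    exact h1
  have hL (x : D.fil i) : L x ∈ D'.fil i := by
    have h1 := D'.fil_mono (show i - 1 ≤ i by omega) (hLfil (i - 1) le_rfl (x - s (q x)) (hmem x))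
    simpa using add_mem h1 (hLs (q x))
  refine ⟨h', fun k hk x hxk hx hdx => ?_, hext⟩
  rw [hext _ hdx (D.diff_fil i x hx), sub_right_comm]
  rcases hk.lt_or_eq with hlt | rfl
  · exact hLfil k (by omega) ⟨x, hx⟩ hxk
  · exact hL ⟨x, hx⟩

/-- Compatible linear maps on the members of an exhaustive filtration glue. -/
theorem exists_glue {N : Type*} [AddCommGroup N] [Module R N] (D : Flag.{u, v, t} 𝓡 a d)
    (h : ∀ n : ℕ, D.fil n →ₗ[R] N)
    (hh : ∀ (n : ℕ) (x : D.carrier) (hx : x ∈ D.fil n) (hx' : x ∈ D.fil (n + 1 : ℕ)),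
      h (n + 1) ⟨x, hx'⟩ = h n ⟨x, hx⟩) :
    ∃ H : D.carrier →ₗ[R] N, ∀ (n : ℕ) (x : D.fil n), H x = h n x := by
  have hle {m n : ℕ} (hmn : m ≤ n) : D.fil m ≤ D.fil n := D.fil_mono (by exact_mod_cast hmn)
  have hcompat {m n : ℕ} (hmn : m ≤ n) (x : D.carrier) (hx : x ∈ D.fil m) :
      h n ⟨x, hle hmn hx⟩ = h m ⟨x, hx⟩ := by
    induction n, hmn using Nat.le_induction with
    | base => rfl
    | succ n hmn ih => rw [hh n x (hle hmn hx), ih]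
  have hex (x : D.carrier) : ∃ n : ℕ, x ∈ D.fil n := by
    obtain ⟨k, hk⟩ := D.fil_exhaustive x
    exact ⟨k.toNat, D.fil_mono (Int.self_le_toNat k) hk⟩
  choose N hN using hex
  have hind (n : ℕ) (x : D.carrier) (hx : x ∈ D.fil n) : h (N x) ⟨x, hN x⟩ = h n ⟨x, hx⟩ := by
    rw [← hcompat (le_max_left (N x) n) x (hN x), ← hcompat (le_max_right (N x) n) x hx]
  refine ⟨⟨⟨fun x => h (N x) ⟨x, hN x⟩, fun x y => ?_⟩, fun r x => ?_⟩, fun n x => hind n x x.2⟩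
  · have hx := hle (le_max_left (N x) (N y)) (hN x)
    have hy := hle (le_max_right (N x) (N y)) (hN y)
    rw [hind _ x hx, hind _ y hy, hind _ (x + y) (add_mem hx hy), ← map_add]
    rfl
  · change h (N (r • x)) ⟨r • x, _⟩ = r • h (N x) ⟨x, _⟩
    rw [hind (N x) (r • x) (Submodule.smul_mem _ r (hN x)), ← map_smul]
    rfl

/-- Any map commuting with the differentials, from a projective flag to a flag anchored on a
resolution, is homotopic to a flag-preserving map, by a homotopy that need not be homogeneous. -/
theorem exists_homotopy_flagPreserving (hD : D.IsProjective)
    (hD'res : D'.AnchoredOnResolution) {φ : D.carrier →ₗ[R] D'.carrier}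
    (hφ : ∀ x, D'.diff (φ x) = φ (D.diff x)) :
    ∃ h : D.carrier →ₗ[R] D'.carrier,
      FlagPreserving D D' (φ - D'.diff ∘ₗ h - h ∘ₗ D.diff) := by
  have hbase : ∃ h : D.fil 0 →ₗ[R] D'.carrier, D.IsPartialHomotopy D' φ 0 h := by
    -- Since `fil (-1) = ⊥`, level `0` is itself an instance of the extension step.
    have h0 : D.IsPartialHomotopy D' φ (-1) 0 := by
      intro k hk x hxk _ _
      rw [D.fil_neg k (by omega), Submodule.mem_bot] at hxk
      simp [hxk]
    obtain ⟨h, hh, -⟩ := h0.exists_extension hD hD'res hφ (i := 0) (by omega) le_rfl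
    exact ⟨h, hh⟩
  -- `choose!` makes `ext` independent of the proof `hh`, so the recursion can run on bare linear
  -- maps.
  choose! ext hext hext' using fun (n : ℕ) (h : D.fil n →ₗ[R] D'.carrier)
    (hh : D.IsPartialHomotopy D' φ n h) =>
      hh.exists_extension hD hD'res hφ (i := (n + 1 : ℕ)) (by push_cast; rfl) (by omega)
  obtain ⟨h₀, hh₀⟩ := hbase
  let H (n : ℕ) : D.fil n →ₗ[R] D'.carrier :=
    Nat.rec (motive := fun n : ℕ => D.fil n →ₗ[R] D'.carrier) h₀ ext n
  have hH (n : ℕ) : D.IsPartialHomotopy D' φ n (H n) := by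
    induction n with
    | zero => exact hh₀
    | succ n ih => exact hext n _ ih
  obtain ⟨h, hh⟩ := D.exists_glue H fun n x hx hx' => hext' n _ (hH n) x hx' hx
  refine ⟨h, fun i x hx => ?_⟩
  have hi : i ≤ i.toNat := Int.self_le_toNat i
  have hx' := D.fil_mono hi hx
  have hdx := D.fil_mono (show i - 1 ≤ i.toNat by omega) (D.diff_fil i x hx)
  have := hH i.toNat i hi x hx hx' hdx
  rwa [← hh, ← hh] at this

end Lift

end Flag

end DiffMod

theorem theorem1p1 {R : Type u} [CommRing R] {A : Type t} [AddCommGroup A] [DecidableEq A]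
    (𝓡 : A → AddSubgroup R) [GradedRing 𝓡] (a : A) (d : ℕ)
    (D : DiffMod.Flag.{u, v, t} 𝓡 a d) (D' : DiffMod.Flag.{u, w, t} 𝓡 a d)
    (hD : D.IsProjective) (hD' : D'.IsProjective)
    (hDres : D.AnchoredOnResolution) (hD'res : D'.AnchoredOnResolution)
    (φ : D.carrier →ₗ[R] D'.carrier) (hφ : DiffMod.IsMorphism D.toDM D'.toDM φ) :
    ∃ ψ h : D.carrier →ₗ[R] D'.carrier,
      DiffMod.IsMorphism D.toDM D'.toDM ψ ∧ DiffMod.Flag.FlagPreserving D D' ψ ∧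
        DiffMod.IsHomotopy D.toDM D'.toDM φ ψ h := by
  obtain ⟨h, hh⟩ := DiffMod.Flag.exists_homotopy_flagPreserving hD hD'res hφ.comm
  -- Degree `0` component of the ungraded identity; `φ` is its own component.
  have hψ : D.component D'.toDM 0 (φ - D'.diff ∘ₗ h - h ∘ₗ D.diff) =
      φ - D'.diff ∘ₗ D.component D'.toDM (-a, 1) h - D.component D'.toDM (-a, 1) h ∘ₗ D.diff := by
    rw [DiffMod.DM.component_sub, DiffMod.DM.component_sub, DiffMod.DM.diff_comp_component,
      DiffMod.DM.component_comp_diff, DiffMod.DM.component_zero_of_isMorphism _ _ hφ]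
  refine ⟨D.component D'.toDM 0 (φ - D'.diff ∘ₗ h - h ∘ₗ D.diff),
    D.component D'.toDM (-a, 1) h, ⟨fun b j x hx => ?_, fun x => ?_⟩, fun i x hx => ?_,
    ⟨fun b j x hx => ?_, ?_⟩⟩
  · rw [D.component_of_mem D'.toDM _ _ hx, add_zero]
    exact DiffMod.gradedProj_mem _ _ _
  · rw [hψ]
    simp [D.diff_diff, D'.diff_diff, hφ.comm]
  · exact DiffMod.homogeneousComponent_mem_of_homogeneous D.piece D'.piece
      (fun k _ hy => D.fil_homogeneous i k hy) (fun k _ hy => D'.fil_homogeneous i k hy)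
      0 _ (hh i) hx
  · rw [D.component_of_mem D'.toDM _ _ hx, sub_eq_add_neg]
    exact DiffMod.gradedProj_mem _ _ _
  · rw [hψ]
    abel
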